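/- Let $k$ be an infinite field, $S=k[x_1,\dots,x_n]$, and let $\Delta$ be a simplicial complex on $[n]$, that is, a set of subsets of $[n]$ (the faces) closed under passing to subsets; its facets are the faces that are maximal under inclusion. For $F\subseteq[n]$ put $m_F=\prod_{i\in F}x_i$. Let $k[\Delta]=S/(m_F : F\subseteq [n],\ F\notin\Delta)$ be the face ring (Stanley–Reisner ring) of $\Delta$, and let $I_{\mathcal F}(\Delta)=(m_F : F \text{ a facet of }\Delta)\subseteq S$ be its facet ideal. A commutative ring $R$ is called clean (in the sense of Dress) if there is a finite filtration $0=M_0\subseteq M_1\subseteq\cdots\subseteq M_r=R$ of $R$ by ideals such that each factor $M_i/M_{i-1}$ is isomorphic, as an $R$-module, to $R/P_i$ for some minimal prime ideal $P_i$ of $R$. An ideal $I\subseteq S$ generated by monomials is said to have linear residuals if its minimal system of monomial generators can be ordered as $m_1,\dots,m_r$ in such a way that, for every $1<i\le r$, the ideal of $S$ generated by $$\operatorname{Res}(I_i)=\Big\{\tfrac{m_i}{\gcd(m_l,m_i)} : 1\le l\le i-1\Big\}$$ is generated by a set of variables (that is, its minimal monomial generators are all linear). Then the face ring $k[\Delta]$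 is clean if and only if the facet ideal $I_{\mathcal F}(\Delta)$ has linear residuals. -/

import Mathlib

open MvPolynomial

noncomputable section

/-- A simplicial complex on the vertex set `[n]`: a set of subsets of `[n]` that is closed under
passing to subsets. Not every `{i}` has to be a face; the void complex (no faces at all) and the
complex `{∅}` are allowed. -/
abbrev SimplicialComplexOn (n : ℕ) : Type := LowerSet (Finset (Fin n))

namespace SimplicialComplexOn

/-- A facet is a face that is maximal under inclusion. -/
def IsFacet {n : ℕ} (Δ : SimplicialComplexOn n) (F : Finset (Fin n)) : Prop :=
  Maximal (fun G : Finset (Fin n) => G ∈ Δ) F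

/-- The square-free monomial `m_F = ∏_{i ∈ F} x_i`. -/
def faceMonomial (k : Type*) [Field k] {n : ℕ} (F : Finset (Fin n)) : MvPolynomial (Fin n) k :=
  ∏ i ∈ F, X i

/-- The non-face (Stanley–Reisner) ideal: generated by the `m_F` with `F` not a face. -/
def nonfaceIdeal (k : Type*) [Field k] {n : ℕ} (Δ : SimplicialComplexOn n) :
    Ideal (MvPolynomial (Fin n) k) :=
  Ideal.span {p | ∃ F : Finset (Fin n), F ∉ Δ ∧ p = faceMonomial k F}

/-- The face ring (Stanley–Reisner ring) `k[Δ]`. -/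
abbrev FaceRing (k : Type*) [Field k] {n : ℕ} (Δ : SimplicialComplexOn n) : Type _ :=
  MvPolynomial (Fin n) k ⧸ nonfaceIdeal k Δ

/-- The facet ideal: generated by the `m_F` with `F` a facet. -/
def facetIdeal (k : Type*) [Field k] {n : ℕ} (Δ : SimplicialComplexOn n) :
    Ideal (MvPolynomial (Fin n) k) :=
  Ideal.span {p | ∃ F : Finset (Fin n), Δ.IsFacet F ∧ p = faceMonomial k F}

end SimplicialComplexOn

/-- A module `M` is clean if it has a finite filtration `0 = M₀ ⊆ M₁ ⊆ ⋯ ⊆ M_r = M` by submodules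
such that each factor `M_{i+1} / M_i` is isomorphic to `R / P_i` for a prime `P_i` that is a minimal
element of the support of `M`. -/
def IsCleanModule (R M : Type*) [CommRing R] [AddCommGroup M] [Module R M] : Prop :=
  ∃ (r : ℕ) (N : Fin (r + 1) → Submodule R M) (P : Fin r → PrimeSpectrum R),
    N 0 = ⊥ ∧ N (Fin.last r) = ⊤ ∧
    ∀ i : Fin r,
      N i.castSucc ≤ N i.succ ∧
      Minimal (fun p : PrimeSpectrum R => p ∈ Module.support R M) (P i) ∧
      Nonempty
        ((N i.succ ⧸ (N i.castSucc).submoduleOf (N i.succ)) ≃ₗ[R] (R ⧸ (P i).asIdeal))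

/-- A commutative ring is clean (in the sense of Dress) if it is clean as a module over itself. This
is not the notion "every element is the sum of a unit and an idempotent". -/
def IsDressCleanRing (R : Type*) [CommRing R] : Prop :=
  IsCleanModule R R

/-- The monomials with exponent vectors `m 0, …, m (r - 1)` form a minimal system of generators of
the ideal `I`: they generate `I`, and none of them lies in the ideal generated by the others. -/
def IsMinimalMonomialSystem {k : Type*} [Field k] {n r : ℕ} (m : Fin r → (Fin n →₀ ℕ))
    (I : Ideal (MvPolynomial (Fin n) k)) : Prop :=
  Ideal.span (Set.range fun i => monomial (m i) (1 : k)) = I ∧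
    ∀ i : Fin r,
      monomial (m i) (1 : k) ∉ Ideal.span ((fun j => monomial (m j) (1 : k)) '' {j | j ≠ i})

/-- The set `Res(I_i)` of the monomials `u_l = m_i / gcd(m_l, m_i)`, `l < i`. On exponent vectors the
gcd of two monomials is the pointwise minimum and the exact quotient is the difference. -/
def residuals (k : Type*) [Field k] {n r : ℕ} (m : Fin r → (Fin n →₀ ℕ)) (i : Fin r) :
    Set (MvPolynomial (Fin n) k) :=
  {u | ∃ l : Fin r, l < i ∧ u = monomial (m i - m l ⊓ m i) (1 : k)}

/-- An ideal `I` of `k[x_1, …, x_n]` has linear residuals if it has an ordered minimal system of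
monomial generators `m_1, …, m_r` such that, for every `1 < i ≤ r`, the ideal generated by
`Res(I_i)` is generated by linear monomials, that is, by a set of variables (a set of variables is
always a minimal system of generators). -/
def HasLinearResiduals {k : Type*} [Field k] {n : ℕ}
    (I : Ideal (MvPolynomial (Fin n) k)) : Prop :=
  ∃ (r : ℕ) (m : Fin r → (Fin n →₀ ℕ)), IsMinimalMonomialSystem m I ∧
    ∀ i : Fin r, 0 < (i : ℕ) →
      ∃ T : Set (Fin n),
        Ideal.span (residuals k m i) = Ideal.span ((fun j => (X j : MvPolynomial (Fin n) k)) '' T)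

end

/-! Both conditions say that `Δ` is shellable in the nonpure sense. A shelling orders the facets so
that, among the faces of `F i` lying in no earlier facet, there is a smallest one, the restriction
face `G i`.

For residuals, `m_i / gcd(m_l, m_i)` is the monomial of `F i \ F l`. The ideal of these is generated
by variables exactly when each `F i \ F l` contains a singleton `F i \ F l'`, and those singletons
make up `G i` (`exists_restriction_iff`, `span_residuals_eq_span_X_iff`).

For cleanness, pull a clean filtration back to the polynomial ring. Its members are the
intersections of the facet primes not yet used (`clean_filtration_eq`). Modulo its own prime, the
generator of a factor is a scalar times a monomial (`exists_support_subset_of_sub_mul_mem`), and the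
support of that monomial is the restriction face. Conversely, the monomials of the `G i` generate
the factors of such a chain of intersections. The filtration runs through the shelling backwards. -/

noncomputable section

/-! ### Square-free exponents and the primes of faces. -/

/-- The exponent vector of the square-free monomial `m_F`. -/
def indicatorExponent {n : ℕ} (F : Finset (Fin n)) : Fin n →₀ ℕ :=
  Finsupp.indicator F fun _ _ => 1

lemma indicatorExponent_apply {n : ℕ} (F : Finset (Fin n)) (i : Fin n) :
    indicatorExponent F i = if i ∈ F then 1 else 0 := by
  simp [indicatorExponent, Finsupp.indicator_apply]

@[simp] lemma support_indicatorExponent {n : ℕ} (F : Finset (Fin n)) :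
    (indicatorExponent F).support = F := by
  ext i; simp [indicatorExponent_apply]

lemma indicatorExponent_le_iff {n : ℕ} (F : Finset (Fin n)) (a : Fin n →₀ ℕ) :
    indicatorExponent F ≤ a ↔ F ⊆ a.support := by
  constructor
  · intro h i hi
    have := h i
    rw [indicatorExponent_apply, if_pos hi] at this
    rw [Finsupp.mem_support_iff]; omega
  · intro h i
    rw [indicatorExponent_apply]
    split_ifs with hi
    · exact Nat.one_le_iff_ne_zero.2 (Finsupp.mem_support_iff.1 (h hi))
    · exact Nat.zero_le _

lemma indicatorExponent_le_indicatorExponent {n : ℕ} {F G : Finset (Fin n)} :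
    indicatorExponent F ≤ indicatorExponent G ↔ F ⊆ G := by
  simp [indicatorExponent_le_iff]

lemma indicatorExponent_sub_inf {n : ℕ} (F G : Finset (Fin n)) :
    indicatorExponent F - indicatorExponent G ⊓ indicatorExponent F =
      indicatorExponent (F \ G) := by
  ext i
  simp only [Finsupp.tsub_apply, Finsupp.inf_apply, indicatorExponent_apply, Finset.mem_sdiff]
  by_cases hF : i ∈ F <;> by_cases hG : i ∈ G <;> simp [hF, hG]

/-- The endomorphism of the polynomial ring that sends the variables outside `F` to zero. -/
def truncation (k : Type*) [Field k] {n : ℕ} (F : Finset (Fin n)) :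
    MvPolynomial (Fin n) k →ₐ[k] MvPolynomial (Fin n) k :=
  aeval fun i => if i ∈ F then X i else 0

/-- The ideal generated by the variables outside `F`, as the kernel of the truncation to `F`. -/
def facePrime (k : Type*) [Field k] {n : ℕ} (F : Finset (Fin n)) :
    Ideal (MvPolynomial (Fin n) k) :=
  RingHom.ker (truncation k F)

section Field

variable {k : Type*} [Field k] {n : ℕ}

instance facePrime_isPrime (F : Finset (Fin n)) : (facePrime k F).IsPrime :=
  RingHom.ker_isPrime _

/-- Truncation deletes terms and alters no other, so membership in `facePrime` can be tested one
monomial at a time. -/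
lemma coeff_truncation (F : Finset (Fin n)) (p : MvPolynomial (Fin n) k) (a : Fin n →₀ ℕ) :
    coeff a (truncation k F p) = if a.support ⊆ F then coeff a p else 0 := by
  induction p using MvPolynomial.induction_on' with
  | add p q hp hq => rw [map_add, coeff_add, coeff_add, hp, hq]; split_ifs <;> simp
  | monomial b c =>
    have key : truncation k F (monomial b c) = if b.support ⊆ F then monomial b c else 0 := by
      rw [truncation, aeval_monomial, algebraMap_eq]
      split_ifs with h
      · rw [monomial_eq]
        congr 1
        exact Finset.prod_congr rfl fun i hi => by simp only [if_pos (h hi)]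
      · obtain ⟨i, hi, hiF⟩ := Finset.not_subset.1 h
        rw [Finsupp.prod, Finset.prod_eq_zero hi, mul_zero]
        rw [if_neg hiF, zero_pow (Finsupp.mem_support_iff.1 hi)]
    rw [key]
    by_cases hab : b = a
    · subst hab; split_ifs <;> simp
    · split_ifs <;> simp [coeff_monomial, hab]

lemma mem_facePrime_iff {F : Finset (Fin n)} {p : MvPolynomial (Fin n) k} :
    p ∈ facePrime k F ↔ ∀ a ∈ p.support, ¬ a.support ⊆ F := by
  rw [facePrime, RingHom.mem_ker, MvPolynomial.ext_iff]
  refine forall_congr' fun a => ?_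
  rw [coeff_truncation, coeff_zero, mem_support_iff]
  split_ifs with h <;> simp [h]

lemma monomial_mem_facePrime_iff {F : Finset (Fin n)} {a : Fin n →₀ ℕ} :
    monomial a (1 : k) ∈ facePrime k F ↔ ¬ a.support ⊆ F := by
  classical
  rw [mem_facePrime_iff, support_monomial, if_neg one_ne_zero]; simp

lemma facePrime_le_facePrime_iff {F G : Finset (Fin n)} :
    facePrime k F ≤ facePrime k G ↔ G ⊆ F := by
  constructor
  · intro h
    by_contra hGF
    have := h (monomial_mem_facePrime_iff.2
      (by rwa [support_indicatorExponent]) : monomial (indicatorExponent G) (1 : k) ∈ _)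
    rw [monomial_mem_facePrime_iff, support_indicatorExponent] at this
    exact this subset_rfl
  · intro h p hp
    rw [mem_facePrime_iff] at hp ⊢
    exact fun a ha h' => hp a ha (h'.trans h)

/-! ### The nonface ideal and its minimal primes. -/

namespace SimplicialComplexOn

variable {Δ : SimplicialComplexOn n}

lemma faceMonomial_eq_monomial (F : Finset (Fin n)) :
    faceMonomial k F = monomial (indicatorExponent F) 1 := by
  have : indicatorExponent F = ∑ i ∈ F, Finsupp.single i 1 := by
    ext j
    simp [indicatorExponent_apply, Finsupp.finsetSum_apply, Finsupp.single_apply]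
  rw [this, monomial_sum_one]; rfl

lemma facetIdeal_eq_span_image :
    facetIdeal k Δ = Ideal.span
      ((fun s => monomial s (1 : k)) '' (indicatorExponent '' {F | Δ.IsFacet F})) := by
  rw [Set.image_image, facetIdeal]
  congr 1
  ext p
  simp [faceMonomial_eq_monomial, eq_comm]

lemma mem_nonfaceIdeal_iff {p : MvPolynomial (Fin n) k} :
    p ∈ nonfaceIdeal k Δ ↔ ∀ a ∈ p.support, a.support ∉ Δ := by
  have : nonfaceIdeal k Δ = Ideal.span
      ((fun s => monomial s (1 : k)) '' (indicatorExponent '' {F | F ∉ Δ})) := by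
    rw [Set.image_image, nonfaceIdeal]
    congr 1
    ext p
    simp [faceMonomial_eq_monomial, eq_comm]
  rw [this, mem_ideal_span_monomial_image]
  refine forall₂_congr fun a _ => ?_
  constructor
  · rintro ⟨_, ⟨F, hF, rfl⟩, h⟩ ha
    exact hF (Δ.lower ((indicatorExponent_le_iff F a).1 h) ha)
  · intro h
    exact ⟨_, ⟨a.support, h, rfl⟩, (indicatorExponent_le_iff _ a).2 subset_rfl⟩

lemma monomial_mem_nonfaceIdeal_iff {a : Fin n →₀ ℕ} :
    monomial a (1 : k) ∈ nonfaceIdeal k Δ ↔ a.support ∉ Δ := by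
  classical
  rw [mem_nonfaceIdeal_iff, support_monomial, if_neg one_ne_zero]; simp

lemma nonfaceIdeal_le_facePrime_iff {F : Finset (Fin n)} :
    nonfaceIdeal k Δ ≤ facePrime k F ↔ F ∈ Δ := by
  constructor
  · intro h
    by_contra hF
    have := h (monomial_mem_nonfaceIdeal_iff.2
      (by rwa [support_indicatorExponent]) : monomial (indicatorExponent F) (1 : k) ∈ _)
    rw [monomial_mem_facePrime_iff, support_indicatorExponent] at this
    exact this subset_rfl
  · intro h p hp
    rw [mem_nonfaceIdeal_iff] at hp
    rw [mem_facePrime_iff]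
    exact fun a ha h' => hp a ha (Δ.lower h' h)

lemma exists_isFacet_ge {F : Finset (Fin n)} (hF : F ∈ Δ) : ∃ G, Δ.IsFacet G ∧ F ⊆ G := by
  obtain ⟨G, hFG, hG⟩ := (Set.toFinite {G : Finset (Fin n) | G ∈ Δ}).exists_le_maximal hF
  exact ⟨G, hG, hFG⟩

lemma IsFacet.eq_of_subset {F G : Finset (Fin n)} (hF : Δ.IsFacet F) (hG : G ∈ Δ)
    (h : F ⊆ G) : F = G :=
  Finset.Subset.antisymm h (hF.2 hG h)

/-- Every prime ideal that contains the nonface ideal contains the prime ideal of a facet. -/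
lemma exists_isFacet_facePrime_le {Q : Ideal (MvPolynomial (Fin n) k)} (hQ : Q.IsPrime)
    (h : nonfaceIdeal k Δ ≤ Q) : ∃ F, Δ.IsFacet F ∧ facePrime k F ≤ Q := by
  classical
  -- The variables outside `Q` form a face: otherwise their product would lie in `Q`, which is
  -- prime.
  let F : Finset (Fin n) := Finset.univ.filter fun i => (X i : MvPolynomial (Fin n) k) ∉ Q
  have hF : F ∈ Δ := by
    by_contra hF
    have : faceMonomial k F ∈ Q := h (Ideal.subset_span ⟨F, hF, rfl⟩)
    obtain ⟨i, hi, hiQ⟩ := (hQ.prod_mem_iff).1 this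
    exact (Finset.mem_filter.1 hi).2 hiQ
  obtain ⟨G, hG, hFG⟩ := exists_isFacet_ge hF
  refine ⟨G, hG, (facePrime_le_facePrime_iff.2 hFG).trans fun p hp => ?_⟩
  rw [mem_facePrime_iff] at hp
  rw [p.as_sum]
  refine Ideal.sum_mem _ fun a ha => ?_
  obtain ⟨i, hi, hiF⟩ := Finset.not_subset.1 (hp a ha)
  have hiQ : (X i : MvPolynomial (Fin n) k) ∈ Q := by
    by_contra hiQ
    exact hiF (Finset.mem_filter.2 ⟨Finset.mem_univ _, hiQ⟩)
  exact Ideal.mem_of_dvd _ (X_dvd_monomial.2 (.inr (Finsupp.mem_support_iff.1 hi))) hiQ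

lemma minimal_support_iff {P : PrimeSpectrum (FaceRing k Δ)} :
    Minimal (fun p : PrimeSpectrum (FaceRing k Δ) =>
        p ∈ Module.support (FaceRing k Δ) (FaceRing k Δ)) P ↔
      ∃ F, Δ.IsFacet F ∧
        P.asIdeal.comap (Ideal.Quotient.mk (nonfaceIdeal k Δ)) = facePrime k F := by
  have hsupp : ∀ p : PrimeSpectrum (FaceRing k Δ),
      p ∈ Module.support (FaceRing k Δ) (FaceRing k Δ) := fun p => by
    rw [Module.support_of_algebra]
    rintro x (rfl : x = 0)
    exact p.asIdeal.zero_mem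
  have hle : ∀ Q : Ideal (FaceRing k Δ), nonfaceIdeal k Δ ≤
      Q.comap (Ideal.Quotient.mk (nonfaceIdeal k Δ)) := fun Q p hp => by
    rw [Ideal.mem_comap, Ideal.Quotient.eq_zero_iff_mem.2 hp]; exact Q.zero_mem
  have hsurj := Ideal.Quotient.mk_surjective (I := nonfaceIdeal k Δ)
  constructor
  · rintro ⟨-, hmin⟩
    obtain ⟨F, hF, hFP⟩ := exists_isFacet_facePrime_le
      (P.isPrime.comap (Ideal.Quotient.mk (nonfaceIdeal k Δ))) (hle P.asIdeal)
    refine ⟨F, hF, le_antisymm ?_ hFP⟩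
    have hker : RingHom.ker (Ideal.Quotient.mk (nonfaceIdeal k Δ)) ≤ facePrime k F := by
      rw [Ideal.mk_ker]; exact nonfaceIdeal_le_facePrime_iff.2 hF.1
    let Q : PrimeSpectrum (FaceRing k Δ) :=
      ⟨(facePrime k F).map (Ideal.Quotient.mk (nonfaceIdeal k Δ)),
        Ideal.map_isPrime_of_surjective hsurj hker⟩
    have hQP : Q ≤ P := Ideal.map_le_iff_le_comap.2 hFP
    have := Ideal.comap_mono (f := Ideal.Quotient.mk (nonfaceIdeal k Δ)) (hmin (hsupp Q) hQP)
    refine this.trans ?_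
    rw [Ideal.comap_map_of_surjective _ hsurj]
    exact sup_le le_rfl hker
  · rintro ⟨F, hF, hFP⟩
    refine ⟨hsupp P, fun Q _ hQP => ?_⟩
    obtain ⟨G, hG, hGQ⟩ := exists_isFacet_facePrime_le
      (Q.isPrime.comap (Ideal.Quotient.mk (nonfaceIdeal k Δ))) (hle Q.asIdeal)
    have h1 : Q.asIdeal.comap (Ideal.Quotient.mk (nonfaceIdeal k Δ)) ≤ facePrime k F :=
      hFP ▸ Ideal.comap_mono hQP
    have := hF.eq_of_subset hG.1 (facePrime_le_facePrime_iff.1 (hGQ.trans h1))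
    subst this
    rw [← hFP] at hGQ
    exact (Ideal.comap_le_comap_iff_of_surjective _ hsurj _ _).1 hGQ

end SimplicialComplexOn
end Field

/-! ### Shellings and restriction faces. -/

namespace SimplicialComplexOn

/-- A (not necessarily pure) shelling, in terms of restriction faces: `F` enumerates the facets
without repetition, and among the faces of `F i` that lie in no earlier facet there is a smallest
one. -/
def IsShelling {n r : ℕ} (Δ : SimplicialComplexOn n) (F : Fin r → Finset (Fin n)) : Prop :=
  Function.Injective F ∧ Set.range F = {A | Δ.IsFacet A} ∧
    ∀ i, ∃ G ⊆ F i, ∀ A ⊆ F i, (∀ l < i, ¬ A ⊆ F l) ↔ G ⊆ A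

end SimplicialComplexOn

/-- The restriction face must consist of the vertices `v` whose removal puts `F i` inside an earlier
facet, that is, `F i \ F l' = {v}`. The right-hand side says that this set lies in no earlier facet.
-/
lemma exists_restriction_iff {n r : ℕ} (F : Fin r → Finset (Fin n)) (i : Fin r)
    (hF : ∀ l < i, ¬ F i ⊆ F l) :
    (∃ G ⊆ F i, ∀ A ⊆ F i, (∀ l < i, ¬ A ⊆ F l) ↔ G ⊆ A) ↔
      ∀ l < i, ∃ l' < i, ∃ v, F i \ F l' = {v} ∧ v ∉ F l := by
  constructor
  · rintro ⟨G, hGF, hG⟩ l hl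
    obtain ⟨v, hvG, hvl⟩ := Finset.not_subset.1 ((hG G hGF).2 subset_rfl l hl)
    -- Without `v` the face no longer contains `G`, hence lies in some earlier `F l'`.
    have : ¬ G ⊆ (F i).erase v := fun h => by simpa using h hvG
    rw [← hG _ (Finset.erase_subset _ _)] at this
    push Not at this
    obtain ⟨l', hl', h⟩ := this
    refine ⟨l', hl', v, ?_, hvl⟩
    have hsub : F i \ F l' ⊆ {v} := fun w hw => by
      rw [Finset.mem_sdiff] at hw
      by_contra hne
      exact hw.2 (h (Finset.mem_erase.2 ⟨by simpa using hne, hw.1⟩))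
    refine (Finset.subset_singleton_iff.1 hsub).resolve_left fun h0 => ?_
    exact hF l' hl' (Finset.sdiff_eq_empty_iff_subset.1 h0)
  · intro h
    refine ⟨(F i).filter fun v => ∃ l' < i, F i \ F l' = {v}, Finset.filter_subset _ _,
      fun A hA => ⟨fun hAl v hv => ?_, fun hGA l hl hAl => ?_⟩⟩
    · obtain ⟨-, l', hl', hv⟩ := Finset.mem_filter.1 hv
      by_contra hvA
      refine hAl l' hl' fun w hw => ?_
      by_contra hwl
      have : w ∈ F i \ F l' := Finset.mem_sdiff.2 ⟨hA hw, hwl⟩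
      rw [hv, Finset.mem_singleton] at this
      exact hvA (this ▸ hw)
    · obtain ⟨l', hl', v, hv, hvl⟩ := h l hl
      have hvF : v ∈ F i := (Finset.mem_sdiff.1 (hv ▸ Finset.mem_singleton_self v)).1
      exact hvl (hAl (hGA (Finset.mem_filter.2 ⟨hvF, l', hl', hv⟩)))

/-! ### Linear residuals and shellings. -/

section Field

variable {k : Type*} [Field k] {n : ℕ}

lemma monomial_mem_span_monomial_image_iff {a : Fin n →₀ ℕ} {s : Set (Fin n →₀ ℕ)} :
    monomial a (1 : k) ∈ Ideal.span ((fun b => monomial b (1 : k)) '' s) ↔ ∃ b ∈ s, b ≤ a := by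
  classical
  rw [mem_ideal_span_monomial_image, support_monomial, if_neg one_ne_zero]; simp

lemma residuals_indicatorExponent {r : ℕ} (F : Fin r → Finset (Fin n)) (i : Fin r) :
    residuals k (fun j => indicatorExponent (F j)) i =
      (fun b => monomial b (1 : k)) '' {b | ∃ l < i, b = indicatorExponent (F i \ F l)} := by
  ext p
  simp only [residuals, indicatorExponent_sub_inf, Set.mem_ofPred_eq, Set.mem_image]
  constructor
  · rintro ⟨l, hl, rfl⟩
    exact ⟨_, ⟨l, hl, rfl⟩, rfl⟩
  · rintro ⟨_, ⟨l, hl, rfl⟩, rfl⟩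
    exact ⟨l, hl, rfl⟩

/-- A monomial lies in a monomial ideal iff a generator divides it. So a variable in `T` is
divisible by some residual, which is not `1` by `hF` and thus equals that variable. -/
lemma span_residuals_eq_span_X_iff {r : ℕ} (F : Fin r → Finset (Fin n)) (i : Fin r)
    (hF : ∀ l < i, ¬ F i ⊆ F l) :
    (∃ T : Set (Fin n), Ideal.span (residuals k (fun j => indicatorExponent (F j)) i) =
        Ideal.span ((fun j => (X j : MvPolynomial (Fin n) k)) '' T)) ↔
      ∀ l < i, ∃ l' < i, ∃ v, F i \ F l' = {v} ∧ v ∉ F l := by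
  classical
  rw [residuals_indicatorExponent]
  have hX : ∀ T : Set (Fin n), (fun j => (X j : MvPolynomial (Fin n) k)) '' T =
      (fun b => monomial b (1 : k)) '' ((fun j => Finsupp.single j 1) '' T) := fun T => by
    rw [Set.image_image]; rfl
  simp only [hX]
  constructor
  · rintro ⟨T, hT⟩ l hl
    have h1 : monomial (indicatorExponent (F i \ F l)) (1 : k) ∈
        Ideal.span ((fun b => monomial b (1 : k)) ''
          {b | ∃ l < i, b = indicatorExponent (F i \ F l)}) :=
      Ideal.subset_span ⟨_, ⟨l, hl, rfl⟩, rfl⟩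
    rw [hT, monomial_mem_span_monomial_image_iff] at h1
    obtain ⟨_, ⟨v, hv, rfl⟩, hle⟩ := h1
    have hvl := hle v
    rw [indicatorExponent_apply, Finsupp.single_eq_same] at hvl
    have hvl : v ∈ F i \ F l := by
      by_contra h
      rw [if_neg h] at hvl
      omega
    have h2 : monomial (Finsupp.single v 1) (1 : k) ∈
        Ideal.span ((fun b => monomial b (1 : k)) '' ((fun j => Finsupp.single j 1) '' T)) :=
      Ideal.subset_span ⟨_, ⟨v, hv, rfl⟩, rfl⟩
    rw [← hT, monomial_mem_span_monomial_image_iff] at h2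
    obtain ⟨_, ⟨l', hl', rfl⟩, hle'⟩ := h2
    rw [indicatorExponent_le_iff] at hle'
    have hle' : F i \ F l' ⊆ {v} := hle'.trans Finsupp.support_single_subset
    refine ⟨l', hl', v, ?_, (Finset.mem_sdiff.1 hvl).2⟩
    exact (Finset.subset_singleton_iff.1 hle').resolve_left fun h0 =>
      hF l' hl' (Finset.sdiff_eq_empty_iff_subset.1 h0)
  · intro h
    refine ⟨{v | ∃ l' < i, F i \ F l' = {v}}, le_antisymm ?_ ?_⟩
    · rw [Ideal.span_le]
      rintro _ ⟨_, ⟨l, hl, rfl⟩, rfl⟩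
      obtain ⟨l', hl', v, hv, hvl⟩ := h l hl
      refine monomial_mem_span_monomial_image_iff.2 ⟨_, ⟨v, ⟨l', hl', hv⟩, rfl⟩, ?_⟩
      have hvF : v ∈ F i := (Finset.mem_sdiff.1 (hv ▸ Finset.mem_singleton_self v)).1
      simp [indicatorExponent_apply, hvF, hvl]
    · rw [Ideal.span_le]
      rintro _ ⟨_, ⟨v, ⟨l', hl', hv⟩, rfl⟩, rfl⟩
      refine monomial_mem_span_monomial_image_iff.2 ⟨_, ⟨l', hl', rfl⟩, ?_⟩
      rw [hv, indicatorExponent_le_iff]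
      simp

namespace SimplicialComplexOn

variable {Δ : SimplicialComplexOn n}

lemma isMinimalMonomialSystem_facetIdeal {r : ℕ} {F : Fin r → Finset (Fin n)}
    (hinj : Function.Injective F) (hF : Set.range F = {A | Δ.IsFacet A}) :
    IsMinimalMonomialSystem (fun i => indicatorExponent (F i)) (facetIdeal k Δ) := by
  have hfacet : ∀ i, Δ.IsFacet (F i) := fun i => hF.le ⟨i, rfl⟩
  constructor
  · rw [facetIdeal_eq_span_image, ← hF, ← Set.range_comp, ← Set.range_comp]; rfl
  · intro i hi
    rw [← Set.image_image (fun b => monomial b (1 : k)) (fun j => indicatorExponent (F j)),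
      monomial_mem_span_monomial_image_iff] at hi
    obtain ⟨_, ⟨j, hj, rfl⟩, hle⟩ := hi
    exact hj (hinj ((hfacet j).eq_of_subset (hfacet i).1
      (indicatorExponent_le_indicatorExponent.1 hle)))

/-- Minimal monomial generators are unique: each `m i` is divisible by a facet monomial, which is
divisible by some `m j`, and minimality forces `j = i`. -/
lemma exists_eq_indicatorExponent {r : ℕ} {m : Fin r → Fin n →₀ ℕ}
    (hm : IsMinimalMonomialSystem m (facetIdeal k Δ)) :
    ∃ F : Fin r → Finset (Fin n), Function.Injective F ∧ Set.range F = {A | Δ.IsFacet A} ∧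
      m = fun i => indicatorExponent (F i) := by
  obtain ⟨hspan, hmin⟩ := hm
  rw [show (Set.range fun i => monomial (m i) (1 : k)) =
    (fun b => monomial b (1 : k)) '' Set.range m from by rw [← Set.range_comp]; rfl] at hspan
  have hmin' : ∀ i j, m j ≤ m i → j = i := fun i j hle => by
    by_contra hne
    refine hmin i ?_
    rw [← Set.image_image (fun b => monomial b (1 : k)) m, monomial_mem_span_monomial_image_iff]
    exact ⟨_, ⟨j, hne, rfl⟩, hle⟩
  have hA : ∀ i, ∃ A, Δ.IsFacet A ∧ indicatorExponent A ≤ m i := fun i => by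
    have : monomial (m i) (1 : k) ∈ facetIdeal k Δ :=
      hspan ▸ Ideal.subset_span ⟨_, ⟨i, rfl⟩, rfl⟩
    rw [facetIdeal_eq_span_image, monomial_mem_span_monomial_image_iff] at this
    obtain ⟨_, ⟨A, hA, rfl⟩, hle⟩ := this
    exact ⟨A, hA, hle⟩
  have hB : ∀ A, Δ.IsFacet A → ∃ j, m j ≤ indicatorExponent A := fun A hA => by
    have : monomial (indicatorExponent A) (1 : k) ∈ facetIdeal k Δ := by
      rw [facetIdeal_eq_span_image]
      exact Ideal.subset_span ⟨_, ⟨A, hA, rfl⟩, rfl⟩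
    rw [← hspan, monomial_mem_span_monomial_image_iff] at this
    obtain ⟨_, ⟨j, rfl⟩, hle⟩ := this
    exact ⟨j, hle⟩
  choose F hF hFm using hA
  have heq : ∀ i, m i = indicatorExponent (F i) := fun i => by
    obtain ⟨j, hj⟩ := hB _ (hF i)
    have := hmin' i j (hj.trans (hFm i))
    subst this
    exact le_antisymm hj (hFm j)
  refine ⟨F, fun i j hij => hmin' j i (by rw [heq, heq, hij]), ?_, funext heq⟩
  ext A
  constructor
  · rintro ⟨i, rfl⟩
    exact hF i
  · intro hA
    obtain ⟨j, hj⟩ := hB A hA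
    rw [heq, indicatorExponent_le_indicatorExponent] at hj
    exact ⟨j, (hF j).eq_of_subset hA.1 hj⟩

lemma not_subset_of_ne {r : ℕ} {F : Fin r → Finset (Fin n)} (hinj : Function.Injective F)
    (hF : Set.range F = {A | Δ.IsFacet A}) {i j : Fin r} (hij : i ≠ j) : ¬ F i ⊆ F j := fun h =>
  have hfacet : ∀ i, Δ.IsFacet (F i) := fun i => hF.le ⟨i, rfl⟩
  hij (hinj ((hfacet i).eq_of_subset (hfacet j).1 h))

theorem hasLinearResiduals_facetIdeal_iff :
    HasLinearResiduals (facetIdeal k Δ) ↔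
      ∃ (r : ℕ) (F : Fin r → Finset (Fin n)), Δ.IsShelling F := by
  constructor
  · rintro ⟨r, m, hm, hres⟩
    obtain ⟨F, hinj, hF, rfl⟩ := exists_eq_indicatorExponent hm
    refine ⟨r, F, hinj, hF, fun i => ?_⟩
    have hnot : ∀ l < i, ¬ F i ⊆ F l := fun l hl => not_subset_of_ne hinj hF hl.ne'
    rw [exists_restriction_iff F i hnot]
    intro l hl
    exact (span_residuals_eq_span_X_iff F i hnot).1 (hres i (Nat.zero_lt_of_lt hl)) l hl
  · rintro ⟨r, F, hinj, hF, h⟩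
    refine ⟨r, _, isMinimalMonomialSystem_facetIdeal hinj hF, fun i _ => ?_⟩
    have hnot : ∀ l < i, ¬ F i ⊆ F l := fun l hl => not_subset_of_ne hinj hF hl.ne'
    exact (span_residuals_eq_span_X_iff F i hnot).2 ((exists_restriction_iff F i hnot).1 (h i))

end SimplicialComplexOn
end Field

/-! ### Clean filtrations and shellings. -/

/-- The factor `B / A` is isomorphic to `R / P` exactly when `B` is generated over `A` by an element
whose annihilator modulo `A` is `P`. -/
lemma nonempty_quotient_linearEquiv_iff {R M : Type*} [CommRing R] [AddCommGroup M] [Module R M]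
    {A B : Submodule R M} {P : Ideal R} :
    Nonempty ((B ⧸ A.submoduleOf B) ≃ₗ[R] (R ⧸ P)) ↔
      ∃ f ∈ B, (∀ b ∈ B, ∃ r : R, b - r • f ∈ A) ∧ ∀ r : R, r • f ∈ A ↔ r ∈ P := by
  have hmem : ∀ b : B, (A.submoduleOf B).mkQ b = 0 ↔ (b : M) ∈ A := fun b => by
    rw [Submodule.mkQ_apply, Submodule.Quotient.mk_eq_zero]; rfl
  constructor
  · rintro ⟨e⟩
    obtain ⟨f, hf⟩ := (A.submoduleOf B).mkQ_surjective (e.symm (Ideal.Quotient.mk P 1))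
    have hrf : ∀ r : R, e ((A.submoduleOf B).mkQ (r • f)) = Ideal.Quotient.mk P r := fun r => by
      rw [map_smul, hf, map_smul, LinearEquiv.apply_symm_apply, map_one, Algebra.smul_def, mul_one]
      rfl
    refine ⟨f, f.2, fun b hb => ?_, fun r => ?_⟩
    · obtain ⟨r, hr⟩ := Ideal.Quotient.mk_surjective (e ((A.submoduleOf B).mkQ ⟨b, hb⟩))
      refine ⟨r, (hmem (⟨b, hb⟩ - r • f)).1 ?_⟩
      apply e.injective
      rw [map_sub, map_sub, hrf, hr, sub_self, map_zero]
    · rw [← Ideal.Quotient.eq_zero_iff_mem, ← hrf, map_eq_zero_iff e e.injective, hmem]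
      rfl
  · rintro ⟨f, hf, hgen, hann⟩
    let φ : R →ₗ[R] (B ⧸ A.submoduleOf B) :=
      LinearMap.toSpanSingleton R _ ((A.submoduleOf B).mkQ ⟨f, hf⟩)
    have hφ : ∀ r, φ r = (A.submoduleOf B).mkQ (r • ⟨f, hf⟩) := fun r => by
      rw [map_smul]; rfl
    have hker : LinearMap.ker φ = P := by
      ext r
      rw [LinearMap.mem_ker, hφ, hmem, ← hann]
      rfl
    have hsurj : Function.Surjective φ := fun y => by
      obtain ⟨b, rfl⟩ := (A.submoduleOf B).mkQ_surjective y
      obtain ⟨r, hr⟩ := hgen b b.2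
      refine ⟨r, ?_⟩
      rw [hφ]
      refine (sub_eq_zero.1 ?_).symm
      rw [← map_sub, hmem]
      exact hr
    exact ⟨((Submodule.quotEquivOfEq _ _ hker).symm.trans
      (φ.quotKerEquivOfSurjective hsurj)).symm⟩

namespace SimplicialComplexOn

variable {k : Type*} [Field k] {n : ℕ} {Δ : SimplicialComplexOn n}

/-- Cleanness of the face ring, in terms of ideals of the polynomial ring. -/
lemma isDressCleanRing_faceRing_iff :
    IsDressCleanRing (FaceRing k Δ) ↔
      ∃ (r : ℕ) (M : Fin (r + 1) → Ideal (MvPolynomial (Fin n) k)) (F : Fin r → Finset (Fin n)),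
        M 0 = nonfaceIdeal k Δ ∧ M (Fin.last r) = ⊤ ∧
        ∀ i : Fin r, M i.castSucc ≤ M i.succ ∧ Δ.IsFacet (F i) ∧
          ∃ f ∈ M i.succ, (∀ b ∈ M i.succ, ∃ g, b - g * f ∈ M i.castSucc) ∧
            ∀ g, g * f ∈ M i.castSucc ↔ g ∈ facePrime k (F i) := by
  have hsurj := Ideal.Quotient.mk_surjective (I := nonfaceIdeal k Δ)
  constructor
  · rintro ⟨r, N, P, h0, h1, h⟩
    choose hle hmin hiso using h
    simp only [minimal_support_iff] at hmin
    choose F hF hFP using hmin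
    refine ⟨r, fun i => Ideal.comap (Ideal.Quotient.mk (nonfaceIdeal k Δ)) (N i), F, ?_, ?_, fun i =>
      ⟨Ideal.comap_mono (hle i), hF i, ?_⟩⟩
    · simp only [h0]
      exact Ideal.mk_ker
    · simp only [h1]
      exact Ideal.comap_top
    · obtain ⟨f, hf, hgen, hann⟩ := nonempty_quotient_linearEquiv_iff.1 (hiso i)
      obtain ⟨f, rfl⟩ := hsurj f
      refine ⟨f, hf, fun b hb => ?_, fun g => ?_⟩
      · obtain ⟨g, hg⟩ := hgen _ hb
        obtain ⟨g, rfl⟩ := hsurj g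
        refine ⟨g, ?_⟩
        rw [Ideal.mem_comap, map_sub, map_mul]
        exact hg
      · rw [← hFP, Ideal.mem_comap, Ideal.mem_comap, ← hann, map_mul]
        rfl
  · rintro ⟨r, M, F, h0, h1, h⟩
    have hI : ∀ i, nonfaceIdeal k Δ ≤ M i := fun i => by
      induction i using Fin.induction with
      | zero => exact h0.ge
      | succ i ih => exact ih.trans (h i).1
    have hcomap : ∀ J : Ideal (MvPolynomial (Fin n) k), nonfaceIdeal k Δ ≤ J →
        (J.map (Ideal.Quotient.mk (nonfaceIdeal k Δ))).comap
          (Ideal.Quotient.mk (nonfaceIdeal k Δ)) = J := fun J hJ => by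
      rw [Ideal.comap_map_of_surjective _ hsurj]
      refine le_antisymm (sup_le le_rfl ?_) le_sup_left
      change RingHom.ker _ ≤ _
      rwa [Ideal.mk_ker]
    have hmem : ∀ J : Ideal (MvPolynomial (Fin n) k), nonfaceIdeal k Δ ≤ J → ∀ p,
        Ideal.Quotient.mk (nonfaceIdeal k Δ) p ∈ J.map (Ideal.Quotient.mk (nonfaceIdeal k Δ)) ↔
          p ∈ J := fun J hJ p => by
      rw [← Ideal.mem_comap, hcomap J hJ]
    have hprime : ∀ i, nonfaceIdeal k Δ ≤ facePrime k (F i) := fun i =>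
      nonfaceIdeal_le_facePrime_iff.2 (h i).2.1.1
    refine ⟨r, fun i => (M i).map (Ideal.Quotient.mk (nonfaceIdeal k Δ)), fun i =>
      ⟨(facePrime k (F i)).map (Ideal.Quotient.mk (nonfaceIdeal k Δ)),
        Ideal.map_isPrime_of_surjective hsurj (by rw [Ideal.mk_ker]; exact hprime i)⟩,
      ?_, ?_, fun i => ⟨Ideal.map_mono (h i).1,
        minimal_support_iff.2 ⟨F i, (h i).2.1, hcomap _ (hprime i)⟩, ?_⟩⟩
    · simp only [h0]
      exact Ideal.map_quotient_self _
    · simp only [h1]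
      exact Ideal.map_top _
    · obtain ⟨-, -, f, hf, hgen, hann⟩ := h i
      refine nonempty_quotient_linearEquiv_iff.2
        ⟨Ideal.Quotient.mk _ f, (hmem _ (hI _) f).2 hf, fun b hb => ?_, fun g => ?_⟩
      · obtain ⟨b, rfl⟩ := hsurj b
        obtain ⟨g, hg⟩ := hgen b ((hmem _ (hI _) b).1 hb)
        refine ⟨Ideal.Quotient.mk _ g, ?_⟩
        rw [smul_eq_mul, ← map_mul, ← map_sub]
        exact (hmem _ (hI _) _).2 hg
      · obtain ⟨g, rfl⟩ := hsurj g
        rw [smul_eq_mul, ← map_mul]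
        exact (hmem _ (hI _) _).trans ((hann g).trans (hmem _ (hprime i) g).symm)

/-- In a clean filtration, the generator of the `i`-th factor avoids the `i`-th prime and lies in
all later ones, and the filtration consists of intersections of the primes of facets. -/
lemma clean_filtration_eq {r : ℕ} {M : Fin (r + 1) → Ideal (MvPolynomial (Fin n) k)}
    {F : Fin r → Finset (Fin n)} {f : Fin r → MvPolynomial (Fin n) k}
    (h0 : M 0 = nonfaceIdeal k Δ) (h1 : M (Fin.last r) = ⊤)
    (hle : ∀ i : Fin r, M i.castSucc ≤ M i.succ) (hF : ∀ i, Δ.IsFacet (F i))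
    (hf : ∀ i, f i ∈ M i.succ)
    (hgen : ∀ i : Fin r, ∀ b ∈ M i.succ, ∃ g, b - g * f i ∈ M i.castSucc)
    (hann : ∀ (i : Fin r) (g), g * f i ∈ M i.castSucc ↔ g ∈ facePrime k (F i)) :
    (∀ i, f i ∉ facePrime k (F i)) ∧ (∀ i j, i < j → f i ∈ facePrime k (F j)) ∧
      ∀ (i : Fin (r + 1)) (p), p ∈ M i ↔ ∀ j : Fin r, i ≤ j.castSucc → p ∈ facePrime k (F j) := by
  have hmono : Monotone M := Fin.monotone_iff_le_succ.2 hle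
  have hI : ∀ i, nonfaceIdeal k Δ ≤ M i := fun i => h0 ▸ hmono (Fin.zero_le i)
  have hnot : ∀ i, f i ∉ facePrime k (F i) := fun i hi => by
    -- A face containing the facet `F i` equals it, whereas every term of `f i` involves a variable
    -- outside `F i`.
    have : monomial (indicatorExponent (F i)) (1 : k) * f i ∈ nonfaceIdeal k Δ := by
      rw [mem_nonfaceIdeal_iff]
      intro a ha haΔ
      rw [mem_support_iff, coeff_monomial_mul', one_mul] at ha
      split_ifs at ha with hle
      · rw [indicatorExponent_le_iff] at hle
        refine (mem_facePrime_iff.1 hi) _ (mem_support_iff.2 ha) ?_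
        rw [(hF i).eq_of_subset haΔ hle]
        exact Finsupp.support_mono tsub_le_self
      · exact ha rfl
    have := (hann i _).1 (hI _ this)
    rw [monomial_mem_facePrime_iff, support_indicatorExponent] at this
    exact this subset_rfl
  have hlt : ∀ i j, i < j → f i ∈ facePrime k (F j) := fun i j hij =>
    (hann j _).1 (Ideal.mul_mem_right _ _
      (hmono (show i.succ ≤ j.castSucc from Fin.succ_le_castSucc_iff.2 hij) (hf i)))
  have hsub : ∀ (i : Fin (r + 1)) (p), p ∈ M i →
      ∀ j : Fin r, i ≤ j.castSucc → p ∈ facePrime k (F j) := fun i => by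
    induction i using Fin.induction with
    | zero => exact fun p hp j _ => nonfaceIdeal_le_facePrime_iff.2 (hF j).1 (h0 ▸ hp)
    | succ i ih =>
      intro p hp j hj
      obtain ⟨g, hg⟩ := hgen i p hp
      have hij : i < j := Fin.succ_le_castSucc_iff.1 hj
      have := ih _ hg j (Fin.castSucc_le_castSucc_iff.2 hij.le)
      exact ((facePrime k (F j)).sub_mem_iff_left (Ideal.mul_mem_left _ _ (hlt i j hij))).1 this
  refine ⟨hnot, hlt, fun i p => ⟨hsub i p, ?_⟩⟩
  -- Descend from `⊤`, the empty intersection. If `p` also lies in the `i`-th prime, so does its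
  -- coefficient `g` along `f i`, and then `g * f i` is already in the smaller ideal.
  induction i using Fin.reverseInduction with
  | last => rw [h1]; exact fun _ => trivial
  | cast i ih =>
    intro hp
    obtain ⟨g, hg⟩ := hgen i p (ih fun j hj => hp j ((Fin.castSucc_lt_succ (i := i)).le.trans hj))
    have hgf : g * f i ∈ facePrime k (F i) :=
      ((facePrime k (F i)).sub_mem_iff_right (hp i le_rfl)).1 (hsub _ _ hg i le_rfl)
    have hgi := ((facePrime_isPrime (F i)).mem_or_mem hgf).resolve_right (hnot i)
    exact ((M i.castSucc).sub_mem_iff_left ((hann i g).2 hgi)).1 hg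

/-- A polynomial that divides a square-free monomial supported in `F` modulo the prime ideal of `F`
is a monomial modulo this ideal. -/
lemma exists_support_subset_of_sub_mul_mem {F : Finset (Fin n)} {f : MvPolynomial (Fin n) k}
    (h : ∃ g, monomial (indicatorExponent F) (1 : k) - g * f ∈ facePrime k F) :
    ∃ a : Fin n →₀ ℕ, a.support ⊆ F ∧ a ∈ f.support ∧ ∀ A ⊆ F,
      (∃ g, monomial (indicatorExponent A) (1 : k) - g * f ∈ facePrime k F) → a.support ⊆ A := by
  have htrunc : ∀ A ⊆ F,
      (∃ g, monomial (indicatorExponent A) (1 : k) - g * f ∈ facePrime k F) →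
        truncation k F f ∣ monomial (indicatorExponent A) (1 : k) := fun A hA ⟨g, hg⟩ => by
    rw [facePrime, RingHom.mem_ker, map_sub, map_mul, sub_eq_zero] at hg
    have : truncation k F (monomial (indicatorExponent A) (1 : k)) =
        monomial (indicatorExponent A) 1 := by
      ext b
      rw [coeff_truncation]
      split_ifs with hb
      · rfl
      · rw [coeff_monomial, if_neg]
        rintro rfl
        exact hb (by rwa [support_indicatorExponent])
    exact ⟨_, by rw [← this, hg, mul_comm]⟩
  obtain ⟨a, c, haF, hc, hac⟩ :=
    (dvd_monomial_iff_exists one_ne_zero).1 (htrunc F subset_rfl h)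
  have hc0 : c ≠ 0 := fun h => one_ne_zero (zero_dvd_iff.1 (h ▸ hc))
  have hsub : a.support ⊆ F := by
    simpa using Finsupp.support_mono haF
  refine ⟨a, hsub, ?_, fun A hA hg => ?_⟩
  -- The exponent `a` occurs in `f` itself, not only in its truncation, so other primes containing
  -- `f` constrain it too.
  · have := coeff_truncation F f a
    rw [hac, coeff_monomial, if_pos rfl, if_pos hsub] at this
    rwa [mem_support_iff, ← this]
  · have := htrunc A hA hg
    rw [hac, monomial_dvd_monomial] at this
    simpa using Finsupp.support_mono (this.1.resolve_left one_ne_zero)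

/-- If `A ⊆ F i` is in no earlier facet, its monomial is a multiple of the generator modulo the
prime of `F i`, so `A` contains the support of `a`. Conversely, the generator lies in the primes of
all earlier facets, so none of them contains that support. -/
theorem exists_isShelling_of_isDressCleanRing (h : IsDressCleanRing (FaceRing k Δ)) :
    ∃ (r : ℕ) (F : Fin r → Finset (Fin n)), Δ.IsShelling F := by
  obtain ⟨r, M, F, h0, h1, h⟩ := isDressCleanRing_faceRing_iff.1 h
  choose hle hF f hf hgen hann using h
  obtain ⟨hnot, hlt, hM⟩ := clean_filtration_eq h0 h1 hle hF hf hgen hann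
  have hinj : Function.Injective F := fun i j hij => by
    by_contra hne
    rcases lt_or_gt_of_ne hne with h | h
    · exact hnot i (hij ▸ hlt i j h)
    · exact hnot j (hij ▸ hlt j i h)
  have hrange : Set.range F = {A | Δ.IsFacet A} := by
    ext A
    refine ⟨?_, fun hA => ?_⟩
    · rintro ⟨i, rfl⟩
      exact hF i
    -- Every facet occurs, because the primes of the `F j` intersect in the nonface ideal, which
    -- omits the monomial of `A`.
    · have : monomial (indicatorExponent A) (1 : k) ∉ M 0 := by
        rw [h0, monomial_mem_nonfaceIdeal_iff, support_indicatorExponent, not_not]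
        exact hA.1
      rw [hM] at this
      push Not at this
      obtain ⟨j, -, hj⟩ := this
      rw [monomial_mem_facePrime_iff, support_indicatorExponent, not_not] at hj
      exact ⟨j, (hA.eq_of_subset (hF j).1 hj).symm⟩
  refine ⟨r, F ∘ Fin.rev, hinj.comp Fin.rev_injective, ?_, fun i => ?_⟩
  · rw [Fin.rev_surjective.range_comp, hrange]
  · have hgen' : ∀ A ⊆ F i.rev, (∀ l < i, ¬ A ⊆ F l.rev) →
        ∃ g, monomial (indicatorExponent A) (1 : k) - g * f i.rev ∈ facePrime k (F i.rev) :=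
      fun A _ hA => by
        obtain ⟨g, hg⟩ := hgen i.rev (monomial (indicatorExponent A) 1) <| (hM _ _).2 fun j hj => by
          rw [monomial_mem_facePrime_iff, support_indicatorExponent]
          have := hA j.rev (Fin.rev_lt_iff.2 (Fin.succ_le_castSucc_iff.1 hj))
          rwa [Fin.rev_rev] at this
        exact ⟨g, (hM _ _).1 hg i.rev le_rfl⟩
    obtain ⟨a, haF, haf, ha⟩ := exists_support_subset_of_sub_mul_mem (hgen' (F i.rev) subset_rfl
      fun l hl => not_subset_of_ne hinj hrange (Fin.rev_injective.ne hl.ne'))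
    refine ⟨a.support, haF, fun A hA => ⟨fun h => ha A hA (hgen' A hA h), fun haA l hl hAl => ?_⟩⟩
    exact mem_facePrime_iff.1 (hlt i.rev l.rev (Fin.rev_lt_rev.2 hl)) a haf (haA.trans hAl)

theorem IsShelling.isDressCleanRing {r : ℕ} {F : Fin r → Finset (Fin n)} (h : Δ.IsShelling F) :
    IsDressCleanRing (FaceRing k Δ) := by
  obtain ⟨hinj, hrange, hG⟩ := h
  have hF : ∀ i, Δ.IsFacet (F i) := fun i => hrange.le ⟨i, rfl⟩
  choose G hGF hG using hG
  have hmem : ∀ (i : Fin (r + 1)) (p : MvPolynomial (Fin n) k),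
      p ∈ (⨅ (j : Fin r) (_ : i ≤ j.castSucc), facePrime k (F j.rev)) ↔
        ∀ j : Fin r, i ≤ j.castSucc → p ∈ facePrime k (F j.rev) := fun i p => by
    simp only [Submodule.mem_iInf]
  have hGmem : ∀ i j : Fin r, i < j →
      monomial (indicatorExponent (G i.rev)) (1 : k) ∈ facePrime k (F j.rev) := fun i j hij => by
    rw [monomial_mem_facePrime_iff, support_indicatorExponent]
    exact (hG i.rev _ (hGF i.rev)).2 subset_rfl _ (Fin.rev_lt_rev.2 hij)
  refine isDressCleanRing_faceRing_iff.2 ⟨r, fun i => ⨅ (j : Fin r) (_ : i ≤ j.castSucc),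
    facePrime k (F j.rev), F ∘ Fin.rev, ?_, ?_, fun i => ⟨?_, hF _,
      monomial (indicatorExponent (G i.rev)) 1, ?_, fun p hp => ?_, fun g => ?_⟩⟩
  · ext p
    rw [hmem, mem_nonfaceIdeal_iff]
    simp only [mem_facePrime_iff]
    refine ⟨fun h a ha haΔ => ?_, fun h j _ a ha haF => h a ha (Δ.lower haF (hF j.rev).1)⟩
    obtain ⟨A, hA, haA⟩ := exists_isFacet_ge haΔ
    obtain ⟨j, rfl⟩ := hrange.ge hA
    exact h j.rev (Fin.zero_le _) a ha (by rwa [Fin.rev_rev])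
  · rw [eq_top_iff]
    intro p _
    rw [hmem]
    exact fun j hj => absurd hj (Fin.castSucc_lt_last j).not_ge
  · intro p hp
    rw [hmem] at hp ⊢
    exact fun j hj => hp j ((Fin.castSucc_lt_succ (i := i)).le.trans hj)
  · exact (hmem _ _).2 fun j hj => hGmem i j (Fin.succ_le_castSucc_iff.1 hj)
  · refine ⟨p.divMonomial (indicatorExponent (G i.rev)), ?_⟩
    -- The remainder keeps exactly the terms of `p` whose support does not contain the restriction
    -- face.
    have hmod : p - p.divMonomial (indicatorExponent (G i.rev)) *
        monomial (indicatorExponent (G i.rev)) 1 =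
          p.modMonomial (indicatorExponent (G i.rev)) := by
      rw [sub_eq_iff_eq_add', mul_comm, divMonomial_add_modMonomial]
    rw [hmod]
    rw [hmem] at hp ⊢
    simp only [mem_facePrime_iff] at hp ⊢
    intro j hj b hb
    have hle : ¬ indicatorExponent (G i.rev) ≤ b := fun hle => by
      rw [mem_support_iff, coeff_modMonomial_of_le _ hle] at hb
      exact hb rfl
    rw [mem_support_iff, coeff_modMonomial_of_not_le _ hle, ← mem_support_iff] at hb
    rw [indicatorExponent_le_iff] at hle
    rcases (Fin.castSucc_le_castSucc_iff.1 hj).eq_or_lt with rfl | hij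
    · intro hbF
      -- Such a term supported in `F i.rev` would be supported in an earlier facet, whose prime
      -- already contains `p`.
      rw [← hG _ _ hbF] at hle
      push Not at hle
      obtain ⟨l, hl, hbl⟩ := hle
      exact hp l.rev (Fin.succ_le_castSucc_iff.2 (Fin.lt_rev_iff.2 hl)) b hb
        (by rwa [Fin.rev_rev])
    · exact hp j (Fin.succ_le_castSucc_iff.2 hij) b hb
  · rw [hmem]
    constructor
    · intro h
      refine ((facePrime_isPrime _).mem_or_mem (h i le_rfl)).resolve_right ?_
      rw [monomial_mem_facePrime_iff, support_indicatorExponent, not_not]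
      exact hGF _
    · intro hg j hj
      rcases (Fin.castSucc_le_castSucc_iff.1 hj).eq_or_lt with rfl | hij
      · exact Ideal.mul_mem_right _ _ hg
      · exact Ideal.mul_mem_left _ _ (hGmem i j hij)

end SimplicialComplexOn

end

theorem corollary3p4 (k : Type*) [Field k] [Infinite k] (n : ℕ) (Δ : SimplicialComplexOn n) :
    IsDressCleanRing (SimplicialComplexOn.FaceRing k Δ) ↔
      HasLinearResiduals (SimplicialComplexOn.facetIdeal k Δ) := by
  rw [SimplicialComplexOn.hasLinearResiduals_facetIdeal_iff]
  exact ⟨SimplicialComplexOn.exists_isShelling_of_isDressCleanRing,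
    fun ⟨_, _, h⟩ => h.isDressCleanRing⟩
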